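/- Let $\mathbb F$ be a field and $n,m,p\ge 0$ integers. A system $(A,B,C)$ with $n$ states, $m$ inputs and $p$ outputs over $\mathbb F$ consists of matrices $A\in\mathbb F^{n\times n}$, $B\in\mathbb F^{n\times m}$, $C\in\mathbb F^{p\times n}$, and is identified with a point of the affine space $\mathbb F^{n^2+n(m+p)}$. Its transfer function is $G(s)=C(sI-A)^{-1}B$, a $p\times m$ matrix over $\mathbb F(s)$. The system has McMillan degree $n$ if no system with fewer states has the same transfer function. Write $G(s)=D(s)^{-1}N(s)$ with $N\in\mathbb F[s]^{p\times m}$ and $D\in\mathbb F[s]^{p\times p}$ left coprime and $\det D\ne 0$. The system is called degenerate if there are $K_1\in\mathbb F^{m\times m}$ and $K_2\in\mathbb F^{m\times p}$ such that $[K_1\ K_2]$ has rank $m$ and $$\det\begin{bmatrix}K_1&K_2\\ N(s)&D(s)\end{bmatrix}=0\quad\text{in }\mathbb F[s]$$ (this does not depend on the choice of the left coprime factorization); otherwise it is called non-degenerate. 1. If $n<mp$, then every system $(A,B,C)$ over $\mathbb F$ with $m$ inputs, $p$ outputs and McMillan degree $n$ is degenerate. 2. If $\mathbb F$ is algebraically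 closed (of any characteristic) and $n\ge mp$, then a generic system $(A,B,C)\in\mathbb F^{n^2+n(m+p)}$ is non-degenerate: there is a proper Zariski-closed subset $Z$ of $\mathbb F^{n^2+n(m+p)}$ such that every system outside $Z$ is non-degenerate. -/

import Mathlib

open Polynomial

noncomputable section

/-- The linear system `x(t+1) = A x(t) + B u(t)`, `y(t) = C x(t)` over `F`, with `n` states,
`m` inputs and `p` outputs. -/
structure LinearSystem (F : Type*) (n m p : ℕ) where
  A : Matrix (Fin n) (Fin n) F
  B : Matrix (Fin n) (Fin m) F
  C : Matrix (Fin p) (Fin n) F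

namespace LinearSystem

/-- The positions of the entries of the three matrices `A`, `B`, `C`:
there are `n ^ 2 + n * (m + p)` of them. -/
abbrev Coord (n m p : ℕ) : Type :=
  (Fin n × Fin n) ⊕ (Fin n × Fin m) ⊕ (Fin p × Fin n)

/-- The identification of the systems `(A, B, C)` with the points of the affine space
`F ^ (n ^ 2 + n * (m + p))`, by listing the matrix entries. -/
def coords {F : Type*} {n m p : ℕ} : LinearSystem F n m p ≃ (Coord n m p → F) where
  toFun S := Sum.elim (fun ij => S.A ij.1 ij.2)
    (Sum.elim (fun ij => S.B ij.1 ij.2) (fun ij => S.C ij.1 ij.2))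
  invFun x :=
    { A := Matrix.of fun i j => x (Sum.inl (i, j))
      B := Matrix.of fun i j => x (Sum.inr (Sum.inl (i, j)))
      C := Matrix.of fun i j => x (Sum.inr (Sum.inr (i, j))) }
  left_inv _ := rfl
  right_inv x := by
    funext c
    rcases c with _ | _ | _ <;> rfl

/-- The transfer function `G(s) = C (s I - A)⁻¹ B`, a `p × m` matrix of rational functions.
`A.charmatrix` is `s I - A`; its determinant is monic, hence nonzero in `F(s)`. -/
def transferFunction {F : Type*} [Field F] {n m p : ℕ} (S : LinearSystem F n m p) :
    Matrix (Fin p) (Fin m) (RatFunc F) :=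
  S.C.map (algebraMap F (RatFunc F)) *
    (S.A.charmatrix.map (algebraMap F[X] (RatFunc F)))⁻¹ *
    S.B.map (algebraMap F (RatFunc F))

end LinearSystem

/-- `G` has McMillan degree `n`: the least number of states in a realization
`G(s) = C (s I - A)⁻¹ B` is `n`. -/
def HasMcMillanDegree {F : Type*} [Field F] {m p : ℕ}
    (G : Matrix (Fin p) (Fin m) (RatFunc F)) (n : ℕ) : Prop :=
  IsLeast {k : ℕ | ∃ S : LinearSystem F k m p, S.transferFunction = G} n

/-- Polynomial matrices `N` and `D` with the same rows are left coprime if all their common left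
divisors are unimodular. -/
def IsLeftCoprime {F : Type*} [Field F] {m p : ℕ}
    (N : Matrix (Fin p) (Fin m) F[X]) (D : Matrix (Fin p) (Fin p) F[X]) : Prop :=
  ∀ (Q : Matrix (Fin p) (Fin p) F[X]) (N' : Matrix (Fin p) (Fin m) F[X])
    (D' : Matrix (Fin p) (Fin p) F[X]), N = Q * N' → D = Q * D' → IsUnit Q

/-- `G = D⁻¹ N` is a left coprime factorization. -/
structure IsLeftCoprimeFactorization {F : Type*} [Field F] {m p : ℕ}
    (G : Matrix (Fin p) (Fin m) (RatFunc F))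
    (N : Matrix (Fin p) (Fin m) F[X]) (D : Matrix (Fin p) (Fin p) F[X]) : Prop where
  det_ne_zero : D.det ≠ 0
  eq_inv_mul : G = (D.map (algebraMap F[X] (RatFunc F)))⁻¹ * N.map (algebraMap F[X] (RatFunc F))
  coprime : IsLeftCoprime N D

/-- The transfer function `G` is degenerate: for a left coprime factorization `G = D⁻¹ N` there is
a constant matrix `[K₁ K₂]` of full rank `m` with `det [K₁ K₂; N(s) D(s)] = 0` in `F[s]`.
The condition does not depend on the factorization, since that determinant is
`det D * det (K₁ - K₂ G)`. -/
def IsDegenerateTransfer {F : Type*} [Field F] {m p : ℕ}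
    (G : Matrix (Fin p) (Fin m) (RatFunc F)) : Prop :=
  ∃ (N : Matrix (Fin p) (Fin m) F[X]) (D : Matrix (Fin p) (Fin p) F[X]),
    IsLeftCoprimeFactorization G N D ∧
    ∃ (K₁ : Matrix (Fin m) (Fin m) F) (K₂ : Matrix (Fin m) (Fin p) F),
      (Matrix.fromCols K₁ K₂).rank = m ∧
      (Matrix.fromBlocks (K₁.map (Polynomial.C : F →+* F[X])) (K₂.map (Polynomial.C : F →+* F[X]))
        N D).det = 0

/-- A system is degenerate if its transfer function is. -/
def LinearSystem.IsDegenerate {F : Type*} [Field F] {n m p : ℕ} (S : LinearSystem F n m p) :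
    Prop :=
  IsDegenerateTransfer S.transferFunction

/-- A Zariski-closed subset of the affine space `F ^ σ`: the set of common zeros of some set of
polynomials. -/
def IsZariskiClosed {F : Type*} [Field F] {σ : Type*} (Z : Set (σ → F)) : Prop :=
  ∃ P : Set (MvPolynomial σ F), Z = {x | ∀ f ∈ P, MvPolynomial.eval x f = 0}

end

noncomputable section

universe u

/-! Degeneracy means that `K₁ - K₂ G` is singular for some constant `[K₁ K₂]` of rank `m`. For `n <
mp`, a dimension count (`exists_coeff_recurrence`) gives a nonzero polynomial row `u` of degree
below `m` such that `uG` is again polynomial of degree below `m`. The row `(uG, u)` has only `m`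
coefficient vectors, so it equals `v [K₁ K₂]` for a constant matrix of rank `m`, and `v (K₁ - K₂ G)
= uG - uG = 0` with `v ≠ 0`.

For `mp ≤ n`, a single system that stays non-degenerate over every extension field suffices:
compensators `[K₁ K₂]` modulo row operations form a Grassmannian, which is complete, so degenerate
systems lie in a proper closed set.

The example (`exists_closedLoopPoly_ne_zero`) has signals tied by a recurrence which, after
rescaling by powers of `s`, is solved by the values of polynomials of degree below `m` at distinct
nodes. A nonzero solution has fewer than `m` zeros, and a comparison of lowest terms excludes `m`
independent constant relations (`eq_zero_of_relations`).

Completeness is used in valuative form: a compensator making the generic system degenerate could be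
normalized over a valuation ring and specialized to one for the example
(`generic_closedLoopPoly_ne_zero`). Localization turns this absence of zeros into a nonzero
polynomial for each choice of minor (`exists_eval_eq_zero`); their product defines `Z`. -/

theorem Submodule.exists_le_finrank_eq {F V : Type*} [Field F] [AddCommGroup V] [Module F V]
    [FiniteDimensional F V] (W : Submodule F V) {k : ℕ} (hW : Module.finrank F W ≤ k)
    (hk : k ≤ Module.finrank F V) : ∃ W' : Submodule F V, W ≤ W' ∧ Module.finrank F W' = k := by
  induction k, hW using Nat.le_induction with
  | base => exact ⟨W, le_rfl, rfl⟩
  | succ k _ ih =>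
    obtain ⟨W', hle, hW'⟩ := ih (by omega)
    obtain ⟨v, hv⟩ := W'.exists_of_finrank_lt (by omega)
    have hvW : v ∉ W' := by simpa using hv 1 one_ne_zero
    refine ⟨W' ⊔ F ∙ v, hle.trans le_sup_left, ?_⟩
    have hv0 : v ≠ 0 := fun h => hvW (h ▸ W'.zero_mem)
    have hdisj : W' ⊓ (F ∙ v) = ⊥ :=
      disjoint_iff.mp ((Submodule.disjoint_span_singleton' hv0).mpr hvW)
    have := Submodule.finrank_sup_add_finrank_inf_eq W' (F ∙ v)
    rw [hdisj, finrank_bot, finrank_span_singleton hv0, hW'] at this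
    exact this

/-! ### Full-rank factorization of constant matrices -/

namespace Matrix

/-- Every matrix with at most as many rows as columns factors through a matrix of the same shape
of full row rank. -/
theorem exists_eq_mul_rank_eq {F ι : Type*} [Field F] [Fintype ι] {m : ℕ}
    (hm : m ≤ Fintype.card ι) (E : Matrix (Fin m) ι F) :
    ∃ (T : Matrix (Fin m) (Fin m) F) (K : Matrix (Fin m) ι F), E = T * K ∧ K.rank = m := by
  obtain ⟨W, hle, hW⟩ := (Submodule.span F (Set.range E.row)).exists_le_finrank_eq (k := m)
    (by rw [← E.rank_eq_finrank_span_row]; simpa using E.rank_le_card_height)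
    (by simpa using hm)
  let b := Module.finBasisOfFinrankEq F W hW
  have hE : ∀ i, E i ∈ W := fun i => hle (Submodule.subset_span ⟨i, rfl⟩)
  refine ⟨of fun i j => b.repr ⟨E i, hE i⟩ j, of fun j => (b j : ι → F), ?_, ?_⟩
  · ext i c
    have := congrArg (fun w : W => (w : ι → F) c) (b.sum_repr ⟨E i, hE i⟩)
    simp only [Submodule.coe_sum, Submodule.coe_smul, Finset.sum_apply, Pi.smul_apply,
      smul_eq_mul] at this
    simp [Matrix.mul_apply, this]
  · have : LinearIndependent F (of fun j => (b j : ι → F)).row :=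
      b.linearIndependent.map' W.subtype (Submodule.ker_subtype W)
    simpa using this.rank_matrix

end Matrix

/-! ### Left coprime factorizations -/

section Factorization

variable {F : Type*} [Field F] {m p : ℕ}

/-- A common left divisor `Q` that is not unimodular can be cancelled without changing `G`. Since
`det Q` is a nonconstant factor of `det D`, the degree of `det D` drops, so the process stops. -/
theorem exists_isLeftCoprimeFactorization_of_eq_inv_mul
    (G : Matrix (Fin p) (Fin m) (RatFunc F)) (N : Matrix (Fin p) (Fin m) F[X])
    (D : Matrix (Fin p) (Fin p) F[X]) (hD : D.det ≠ 0)
    (hG : G = (D.map (algebraMap F[X] (RatFunc F)))⁻¹ * N.map (algebraMap F[X] (RatFunc F))) :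
    ∃ N' D', IsLeftCoprimeFactorization G N' D' := by
  induction hd : D.det.natDegree using Nat.strong_induction_on generalizing N D with
  | _ d ih =>
    by_cases hco : IsLeftCoprime N D
    · exact ⟨N, D, hD, hG, hco⟩
    · simp only [IsLeftCoprime, not_forall] at hco
      obtain ⟨Q, N', D', hN', hD', hQ⟩ := hco
      have hdet : D.det = Q.det * D'.det := by rw [hD', Matrix.det_mul]
      have hQ0 : Q.det ≠ 0 := fun h => hD (by rw [hdet, h, zero_mul])
      have hD'0 : D'.det ≠ 0 := fun h => hD (by rw [hdet, h, mul_zero])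
      have hQdeg : Q.det.natDegree ≠ 0 := fun h => hQ <| by
        rw [Matrix.isUnit_iff_isUnit_det, Polynomial.isUnit_iff_degree_eq_zero,
          Polynomial.degree_eq_natDegree hQ0, h]
        rfl
      refine ih D'.det.natDegree ?_ N' D' hD'0 ?_ rfl
      · rw [← hd, hdet, natDegree_mul hQ0 hD'0]
        omega
      · have hu : IsUnit (Q.map (algebraMap F[X] (RatFunc F))).det := by
          rw [← RingHom.mapMatrix_apply, ← RingHom.map_det, isUnit_iff_ne_zero]
          simpa using hQ0
        rw [hG, hN', hD', Matrix.map_mul, Matrix.map_mul, Matrix.mul_inv_rev, Matrix.mul_assoc,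
          ← Matrix.mul_assoc _ (Q.map _), Matrix.nonsing_inv_mul _ hu, Matrix.one_mul]

end Factorization

/-! ### Degeneracy for `n < mp` -/

namespace LinearSystem

variable {F : Type*} [Field F] {n m p : ℕ}

theorem isUnit_det_charmatrix_map (A : Matrix (Fin n) (Fin n) F) :
    IsUnit (A.charmatrix.map (algebraMap F[X] (RatFunc F))).det := by
  rw [← RingHom.mapMatrix_apply, ← RingHom.map_det, isUnit_iff_ne_zero]
  simpa [Matrix.charpoly] using A.charpoly_monic.ne_zero

theorem algebraMap_map_eq {R : Type*} {α β : Type*} [CommSemiring R] [Algebra F R]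
    (M : Matrix α β F) [Algebra F[X] R] [IsScalarTower F F[X] R] :
    M.map (algebraMap F R) = (M.map (Polynomial.C : F →+* F[X])).map (algebraMap F[X] R) := by
  ext i j
  simp [IsScalarTower.algebraMap_apply F F[X] R]

theorem exists_isLeftCoprimeFactorization (S : LinearSystem F n m p) :
    ∃ N D, IsLeftCoprimeFactorization S.transferFunction N D := by
  have hq : S.A.charpoly ≠ 0 := S.A.charpoly_monic.ne_zero
  have hq' : algebraMap F[X] (RatFunc F) S.A.charpoly ≠ 0 := by simpa using hq
  refine exists_isLeftCoprimeFactorization_of_eq_inv_mul S.transferFunction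
    (S.C.map Polynomial.C * S.A.charmatrix.adjugate * S.B.map Polynomial.C) (Matrix.diagonal fun _ => S.A.charpoly)
    (by simp [Matrix.det_diagonal, hq]) ?_
  have hinv : ((Matrix.diagonal fun _ : Fin p => S.A.charpoly).map
      (algebraMap F[X] (RatFunc F)))⁻¹ =
        (algebraMap F[X] (RatFunc F) S.A.charpoly)⁻¹ • (1 : Matrix (Fin p) (Fin p) _) := by
    apply Matrix.inv_eq_left_inv
    rw [Matrix.diagonal_map (map_zero _), Matrix.smul_mul, Matrix.one_mul]
    ext i j
    by_cases h : i = j <;> simp [h, hq', Matrix.one_apply]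
  rw [hinv, transferFunction, Matrix.inv_def, Matrix.map_mul, Matrix.map_mul,
    algebraMap_map_eq S.C, algebraMap_map_eq S.B, ← RingHom.mapMatrix_apply (algebraMap F[X] _)
    S.A.charmatrix, ← RingHom.map_det, ← RingHom.map_adjugate, Ring.inverse_eq_inv',
    Matrix.smul_mul, Matrix.mul_smul, Matrix.smul_mul, Matrix.one_mul]
  rfl

/-- If `n < m * p`, a nonzero polynomial row vector of degree less than `m` is mapped by `G` to a
polynomial row vector of degree less than `m`. Here `w` and `ρ B` are the coefficients. -/
theorem exists_coeff_recurrence (h : n < m * p) (S : LinearSystem F n m p) :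
    ∃ (w : ℕ → Fin p → F) (ρ : ℕ → Fin n → F), (∃ k < m, w k ≠ 0) ∧ ρ 0 = 0 ∧ ρ m = 0 ∧
      ∀ k < m, ρ k = Matrix.vecMul (w k) S.C + Matrix.vecMul (ρ (k + 1)) S.A := by
  let Ψ : (Fin m → Fin p → F) →ₗ[F] (Fin n → F) :=
    ∑ k : Fin m, (S.C * S.A ^ (k : ℕ)).vecMulLinear ∘ₗ LinearMap.proj k
  have hker : LinearMap.ker Ψ ≠ ⊥ := LinearMap.ker_ne_bot_of_finrank_lt (by
    simpa [Module.finrank_pi_fintype] using h)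
  obtain ⟨w, hw, hw0⟩ := (Submodule.ne_bot_iff _).mp hker
  let w' : ℕ → Fin p → F := fun k => if hk : k < m then w ⟨k, hk⟩ else 0
  -- For `u = ∑ s ^ k w k`, the expansion of `u C (sI - A)⁻¹` at infinity has `ρ (k + 1)` as
  -- coefficient of `s ^ k` and `ρ 0 A ^ t` as coefficient of `s ^ (-1 - t)`. So `ρ 0 = Ψ w = 0`
  -- makes it a polynomial.
  let ρ : ℕ → Fin n → F := fun k =>
    ∑ j ∈ Finset.Ico k m, Matrix.vecMul (w' j) (S.C * S.A ^ (j - k))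
  refine ⟨w', ρ, ?_, ?_, by simp [ρ], ?_⟩
  · obtain ⟨k, hk⟩ := Function.ne_iff.mp hw0
    exact ⟨k, k.2, by simpa [w'] using hk⟩
  · have : Ψ w = 0 := hw
    rw [← this]
    simp only [ρ, Nat.Ico_zero_eq_range, Finset.sum_range, Ψ, w']
    simp
  · intro k hk
    simp only [ρ]
    rw [Finset.sum_eq_sum_Ico_succ_bot hk, Matrix.sum_vecMul]
    congr 1
    · simp
    · refine Finset.sum_congr rfl fun j hj => ?_
      rw [Matrix.vecMul_vecMul, Matrix.mul_assoc, ← pow_succ]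
      congr 3
      simp at hj
      omega

theorem vecMul_map_C_sum {R α β : Type*} [CommRing R] [Fintype α] (M : Matrix α β R)
    (f : Fin m → α → R) :
    Matrix.vecMul (fun i => ∑ k : Fin m, X ^ (k : ℕ) * Polynomial.C (f k i)) (M.map Polynomial.C) =
      fun i => ∑ k : Fin m, X ^ (k : ℕ) * Polynomial.C (Matrix.vecMul (f k) M i) := by
  ext1 i
  simp only [Matrix.vecMul, dotProduct, Matrix.map_apply, map_sum, map_mul, Finset.mul_sum,
    Finset.sum_mul, mul_assoc]
  rw [Finset.sum_comm]

theorem isDegenerate_of_lt (h : n < m * p) (S : LinearSystem F n m p) : S.IsDegenerate := by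
  obtain ⟨N, D, hND⟩ := S.exists_isLeftCoprimeFactorization
  obtain ⟨w, ρ, ⟨k₀, hk₀, hwk₀⟩, hρ0, hρm, hρ⟩ := exists_coeff_recurrence h S
  -- Row `k` is the coefficient of `s ^ k` in `(rB, u)`, so that `(rB, u) = (1, s, …, s ^ (m - 1))
  -- E`.
  let E : Matrix (Fin m) (Fin m ⊕ Fin p) F :=
    Matrix.of fun k => Sum.elim (Matrix.vecMul (ρ (k + 1)) S.B) (w k)
  obtain ⟨T, K, hE, hK⟩ := E.exists_eq_mul_rank_eq (by simp)
  refine ⟨N, D, hND, K.toCols₁, K.toCols₂, by rw [Matrix.fromCols_toCols, hK], ?_⟩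
  let ι := algebraMap F[X] (RatFunc F)
  let t : Fin m → F[X] := fun k => X ^ (k : ℕ)
  let r : Fin n → F[X] := fun i => ∑ k : Fin m, X ^ (k : ℕ) * Polynomial.C (ρ (k + 1) i)
  let u : Fin p → F[X] := fun i => ∑ k : Fin m, X ^ (k : ℕ) * Polynomial.C (w k i)
  let v : Fin m → F[X] := Matrix.vecMul t (T.map Polynomial.C)
  have hr : Matrix.vecMul r S.A.charmatrix = Matrix.vecMul u (S.C.map Polynomial.C) := by
    have hX : ∀ i, Matrix.vecMul r (Matrix.scalar (Fin n) (X : F[X])) i = X * r i := fun i => by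
      simp [Matrix.scalar_apply, Matrix.vecMul_diagonal, mul_comm]
    ext1 i
    rw [Matrix.charmatrix, Matrix.vecMul_sub, Pi.sub_apply, hX, RingHom.mapMatrix_apply,
      vecMul_map_C_sum, vecMul_map_C_sum]
    simp only [r, Finset.mul_sum, ← Finset.sum_sub_distrib]
    -- By the recurrence, `r (sI - A) - uC` is a telescoping sum; both of its ends vanish because `ρ
    -- 0 = ρ m = 0`.
    have htel := Finset.sum_range_sub
      (fun k => (X : F[X]) ^ k * Polynomial.C (ρ k i)) m
    rw [hρ0, hρm, Finset.sum_range] at htel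
    simp only [Pi.zero_apply, map_zero, mul_zero, sub_zero] at htel
    rw [← sub_eq_zero, ← Finset.sum_sub_distrib, ← htel]
    refine Finset.sum_congr rfl fun k _ => ?_
    rw [hρ k k.2, Pi.add_apply, map_add]
    ring
  have hv : Matrix.vecMul v (K.map Polynomial.C) = Sum.elim (Matrix.vecMul r (S.B.map Polynomial.C)) u := by
    rw [Matrix.vecMul_vecMul, ← Matrix.map_mul, ← hE]
    ext1 c
    rw [vecMul_map_C_sum]
    cases c <;> simp [Matrix.vecMul, dotProduct, E, t, u]
  have hu : u ≠ 0 := by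
    obtain ⟨i, hi⟩ := Function.ne_iff.mp hwk₀
    refine fun hu => hi ?_
    have := congrArg (fun q => coeff q k₀) (congrFun hu i)
    simp only [u, finsetSum_coeff, coeff_X_pow_mul', coeff_C] at this
    rw [Finset.sum_eq_single ⟨k₀, hk₀⟩] at this
    · simpa using this
    · intro b _ hb
      have : (b : ℕ) ≠ k₀ := fun h => hb (Fin.ext h)
      split_ifs <;> first | rfl | omega
    · simp
  have hv0 : v ≠ 0 := by
    intro h
    rw [h, Matrix.zero_vecMul] at hv
    exact hu (funext fun i => (congrFun hv (Sum.inr i)).symm)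
  have hDu : IsUnit (D.map ι).det := by
    rw [← RingHom.mapMatrix_apply, ← RingHom.map_det, isUnit_iff_ne_zero]
    simpa [ι] using hND.det_ne_zero
  have hG : Matrix.vecMul (ι ∘ u) S.transferFunction = ι ∘ Matrix.vecMul r (S.B.map Polynomial.C) := by
    have h1 : Matrix.vecMul (ι ∘ u) (S.C.map (algebraMap F (RatFunc F))) =
        Matrix.vecMul (ι ∘ r) (S.A.charmatrix.map ι) := by
      rw [algebraMap_map_eq]
      ext1 i
      rw [← RingHom.map_vecMul, ← RingHom.map_vecMul, hr]
    rw [transferFunction, ← Matrix.vecMul_vecMul, ← Matrix.vecMul_vecMul, h1,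
      Matrix.vecMul_vecMul _ (S.A.charmatrix.map ι),
      Matrix.mul_nonsing_inv _ (isUnit_det_charmatrix_map S.A), Matrix.vecMul_one,
      algebraMap_map_eq]
    ext1 i
    rw [← RingHom.map_vecMul]
    rfl
  suffices ((Matrix.fromBlocks (K.toCols₁.map Polynomial.C) (K.toCols₂.map Polynomial.C) N D).map
      ι).det = 0 by
    rw [← RingHom.mapMatrix_apply, ← RingHom.map_det] at this
    simpa [ι] using this
  rw [← Matrix.exists_vecMul_eq_zero_iff]
  -- `v [K₁ K₂] = (uG, u) = u D⁻¹ [N D]`, so `(v, -u D⁻¹)` is a left kernel vector.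
  refine ⟨Sum.elim (ι ∘ v) (-Matrix.vecMul (ι ∘ u) (D.map ι)⁻¹), ?_, ?_⟩
  · obtain ⟨i, hi⟩ := Function.ne_iff.mp hv0
    refine Function.ne_iff.mpr ⟨Sum.inl i, ?_⟩
    simpa [ι] using hi
  · rw [Matrix.fromBlocks_map, Matrix.vecMul_fromBlocks, Sum.elim_comp_inl, Sum.elim_comp_inr,
      Matrix.neg_vecMul, Matrix.neg_vecMul,
      Matrix.vecMul_vecMul, Matrix.vecMul_vecMul, Matrix.nonsing_inv_mul _ hDu, Matrix.vecMul_one]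
    have h1 : Matrix.vecMul (ι ∘ v) ((K.toCols₁.map Polynomial.C).map ι) =
        ι ∘ Matrix.vecMul r (S.B.map Polynomial.C) := by
      ext1 i
      rw [← RingHom.map_vecMul]
      exact congrArg ι (congrFun hv (Sum.inl i))
    have h2 : Matrix.vecMul (ι ∘ v) ((K.toCols₂.map Polynomial.C).map ι) = ι ∘ u := by
      ext1 i
      rw [← RingHom.map_vecMul]
      exact congrArg ι (congrFun hv (Sum.inr i))
    have h3 : (D.map ι)⁻¹ * N.map ι = S.transferFunction := hND.eq_inv_mul.symm
    rw [h1, h2, h3, hG]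
    simp

end LinearSystem

/-! ### The closed-loop polynomial -/

theorem Matrix.exists_det_submatrix_ne_zero {F ι : Type*} [Field F] [Fintype ι] {m : ℕ}
    {K : Matrix (Fin m) ι F} (hK : K.rank = m) :
    ∃ g : Fin m → ι, (K.submatrix id g).det ≠ 0 := by
  have hf := Submodule.exists_fun_fin_finrank_span_eq F (Set.range K.col)
  rw [← Matrix.rank_eq_finrank_span_cols, hK] at hf
  obtain ⟨f, hf, -, hli⟩ := hf
  choose g hg using hf
  refine ⟨g, ?_⟩
  rw [← isUnit_iff_ne_zero, ← Matrix.isUnit_iff_isUnit_det, ← Matrix.linearIndependent_cols_iff_isUnit]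
  rwa [← show (K.submatrix id g).col = f from _root_.funext hg] at hli

namespace LinearSystem

variable {n m p : ℕ}

/-- Base change of a system along a map of coefficients. -/
def map {R R' : Type*} (φ : R → R') (S : LinearSystem R n m p) : LinearSystem R' n m p where
  A := S.A.map φ
  B := S.B.map φ
  C := S.C.map φ

section CommRing

variable {R R' : Type*} [CommRing R] [CommRing R']

/-- For `K = [K₁ K₂]`, the polynomial `det (s I - A) * det (K₁ - K₂ C (s I - A)⁻¹ B)`, as a
determinant of a polynomial matrix. -/
def closedLoopPoly (S : LinearSystem R n m p) (K : Matrix (Fin m) (Fin m ⊕ Fin p) R) : R[X] :=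
  (Matrix.fromBlocks S.A.charmatrix (S.B.map Polynomial.C) ((K.toCols₂ * S.C).map Polynomial.C)
    (K.toCols₁.map Polynomial.C)).det

theorem closedLoopPoly_map (φ : R →+* R') (S : LinearSystem R n m p)
    (K : Matrix (Fin m) (Fin m ⊕ Fin p) R) :
    (S.map φ).closedLoopPoly (K.map φ) = (S.closedLoopPoly K).map φ := by
  have hC : ∀ {α β : Type} (M : Matrix α β R), (M.map φ).map (Polynomial.C : R' →+* R'[X]) =
      (M.map Polynomial.C).map (Polynomial.mapRingHom φ) := fun M => by
    ext i j : 2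
    simp
  have h₁ : (K.map φ).toCols₁ = K.toCols₁.map φ := rfl
  have h₂ : (K.map φ).toCols₂ = K.toCols₂.map φ := rfl
  rw [← Polynomial.coe_mapRingHom, closedLoopPoly, closedLoopPoly, RingHom.map_det,
    RingHom.mapMatrix_apply, Matrix.fromBlocks_map, h₁, h₂]
  simp only [map]
  rw [← Matrix.map_mul, hC, hC, hC, Matrix.charmatrix_map]
  rfl

/-- Left multiplication acts on the last block row only. For invertible `g`, vanishing thus depends
only on the row space of `K`, a point of the Grassmannian. -/
theorem closedLoopPoly_mul (S : LinearSystem R n m p) (g : Matrix (Fin m) (Fin m) R)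
    (K : Matrix (Fin m) (Fin m ⊕ Fin p) R) :
    S.closedLoopPoly (g * K) = Polynomial.C g.det * S.closedLoopPoly K := by
  have h : Matrix.fromBlocks S.A.charmatrix (S.B.map Polynomial.C)
      (((g * K).toCols₂ * S.C).map Polynomial.C) ((g * K).toCols₁.map Polynomial.C) =
      Matrix.fromBlocks 1 0 0 (g.map Polynomial.C) * Matrix.fromBlocks S.A.charmatrix
        (S.B.map Polynomial.C) ((K.toCols₂ * S.C).map Polynomial.C)
        (K.toCols₁.map Polynomial.C) := by
    have h₁ : (g * K).toCols₁ = g * K.toCols₁ := rfl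
    have h₂ : (g * K).toCols₂ = g * K.toCols₂ := rfl
    simp [Matrix.fromBlocks_multiply, h₁, h₂, Matrix.mul_assoc, ← Matrix.map_mul]
  rw [closedLoopPoly, h, Matrix.det_mul, Matrix.det_fromBlocks_zero₂₁, Matrix.det_one, one_mul,
    ← RingHom.mapMatrix_apply, ← RingHom.map_det, closedLoopPoly]

end CommRing

/-- By Schur complements, both determinants are nonzero multiples of `det (K₁ - K₂ G)`: one by `det
D`, the other by `det (sI - A)`. -/
theorem IsDegenerate.exists_closedLoopPoly_eq_zero {F : Type*} [Field F]
    {S : LinearSystem F n m p} (hS : S.IsDegenerate) :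
    ∃ K : Matrix (Fin m) (Fin m ⊕ Fin p) F, K.rank = m ∧ S.closedLoopPoly K = 0 := by
  obtain ⟨N, D, hND, K₁, K₂, hrank, hdet⟩ := hS
  refine ⟨Matrix.fromCols K₁ K₂, hrank, ?_⟩
  let ι := algebraMap F[X] (RatFunc F)
  have hDu : IsUnit (D.map ι).det := by
    rw [← RingHom.mapMatrix_apply, ← RingHom.map_det, isUnit_iff_ne_zero]
    simpa [ι] using hND.det_ne_zero
  have hAu : IsUnit (S.A.charmatrix.map ι).det := isUnit_det_charmatrix_map S.A
  have hG := hND.eq_inv_mul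
  let := Matrix.invertibleOfIsUnitDet _ hDu
  let := Matrix.invertibleOfIsUnitDet _ hAu
  replace hdet := congrArg ι hdet
  rw [RingHom.map_det, RingHom.mapMatrix_apply, Matrix.fromBlocks_map, Matrix.det_fromBlocks₂₂,
    Matrix.invOf_eq_nonsing_inv, Matrix.mul_assoc, ← hG, map_zero,
    mul_eq_zero_iff_left hDu.ne_zero] at hdet
  suffices ι (S.closedLoopPoly (Matrix.fromCols K₁ K₂)) = 0 by simpa [ι] using this
  rw [closedLoopPoly, RingHom.map_det, RingHom.mapMatrix_apply, Matrix.fromBlocks_map,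
    Matrix.det_fromBlocks₁₁, Matrix.invOf_eq_nonsing_inv, Matrix.toCols₁_fromCols,
    Matrix.toCols₂_fromCols]
  rw [transferFunction, algebraMap_map_eq S.B, algebraMap_map_eq S.C] at hdet
  rw [Matrix.map_mul, Matrix.map_mul]
  simp only [Matrix.mul_assoc] at hdet ⊢
  rw [hdet, mul_zero]

end LinearSystem

/-! ### Interpolation recurrences and their zeros -/

section Interpolation

variable {F : Type*} [Field F]

/-- `c` expresses the value at each node `a i` of a polynomial of degree less than `m` through the
values at the next `m` nodes. -/
def IsInterpolationWeight (m : ℕ) (a : ℕ → F) (c : ℕ → ℕ → F) : Prop :=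
  ∀ i, ∀ q < m, a i ^ q + ∑ l ∈ Finset.range m, c i l * a (i + l + 1) ^ q = 0

/-- A monomial of degree below `m` is its own Lagrange interpolant on the `m` nodes after `a i`;
evaluation at `a i` gives the weights, up to sign. -/
theorem exists_isInterpolationWeight (m : ℕ) {a : ℕ → F} (ha : Function.Injective a) :
    ∃ c, IsInterpolationWeight m a c := by
  refine ⟨fun i l => -(Lagrange.basis (Finset.range m) (fun l => a (i + l + 1)) l).eval (a i),
    fun i q hq => ?_⟩
  have hinj : Set.InjOn (fun l => a (i + l + 1)) (Finset.range m : Set ℕ) :=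
    fun x _ y _ h => by have := ha h; omega
  have := Lagrange.eq_interpolate (f := X ^ q) hinj (by simpa using hq)
  have := congrArg (eval (a i)) this
  simp only [Lagrange.interpolate_apply, eval_finsetSum, eval_mul, eval_C, eval_pow, eval_X] at this
  rw [this, ← Finset.sum_add_distrib]
  exact Finset.sum_eq_zero fun l _ => by ring

theorem IsInterpolationWeight.map {E : Type*} [Field E] {m : ℕ} {a : ℕ → F} {c : ℕ → ℕ → F}
    (hc : IsInterpolationWeight m a c) (φ : F →+* E) :
    IsInterpolationWeight m (fun i => φ (a i)) (fun i l => φ (c i l)) := fun i q hq => by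
  simpa using congrArg φ (hc i q hq)

theorem IsInterpolationWeight.eval_eq {m : ℕ} {a : ℕ → F} {c : ℕ → ℕ → F}
    (hc : IsInterpolationWeight m a c) {P : F[X]} (hP : P.degree < m) (i : ℕ) :
    P.eval (a i) + ∑ l ∈ Finset.range m, c i l * P.eval (a (i + l + 1)) = 0 := by
  rcases eq_or_ne P 0 with rfl | hP0
  · simp
  have hPm : P.natDegree < m := (natDegree_lt_iff_degree_lt hP0).mpr hP
  simp only [eval_eq_sum_range' hPm, Finset.mul_sum]
  rw [Finset.sum_comm, ← Finset.sum_add_distrib]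
  refine Finset.sum_eq_zero fun q hq => ?_
  have := congrArg (P.coeff q * ·) (hc i q (Finset.mem_range.mp hq))
  simp only [mul_add, mul_zero, Finset.mul_sum] at this
  rw [← this]
  congr 1
  exact Finset.sum_congr rfl fun l _ => by ring

/-- A nonzero solution of the recurrence with interpolation weights has fewer than `m` zeros. -/
theorem IsInterpolationWeight.card_zeros_lt {m p : ℕ} {a : ℕ → F} (ha : Function.Injective a)
    {c : ℕ → ℕ → F} (hc : IsInterpolationWeight m a c) {z : ℕ → F}
    (hz : ∀ i < p, z i + ∑ l ∈ Finset.range m, c i l * z (i + l + 1) = 0)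
    (hz0 : ∃ j < p + m, z j ≠ 0) [DecidablePred fun j => z j = 0] :
    ((Finset.range (p + m)).filter fun j => z j = 0).card < m := by
  have hinj : Set.InjOn (fun l => a (p + l)) (Finset.range m : Set ℕ) :=
    fun x _ y _ h => by have := ha h; omega
  -- `P` matches the last `m` values of `z`; the recurrence, run downwards, forces `z j = P (a j)`
  -- everywhere.
  set P := Lagrange.interpolate (Finset.range m) (fun l => a (p + l)) (fun l => z (p + l)) with hP
  have hdeg : P.degree < m := by
    exact (Lagrange.degree_interpolate_lt (fun l => z (p + l)) hinj).trans_eq (by simp)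
  have key : ∀ k j, p - k ≤ j → j < p + m → z j = P.eval (a j) := by
    intro k
    induction k with
    | zero =>
      intro j hj hj'
      obtain ⟨l, rfl⟩ := Nat.exists_eq_add_of_le (show p ≤ j by omega)
      exact (Lagrange.eval_interpolate_at_node (fun l => z (p + l)) hinj
        (Finset.mem_coe.mpr (Finset.mem_range.mpr (by omega)))).symm
    | succ k ih =>
      intro j hj hj'
      by_cases h : p - k ≤ j
      · exact ih j h hj'
      have h1 := hz j (by omega)
      have h2 := hc.eval_eq hdeg j
      rw [← h2] at h1
      refine add_right_cancel (h1.trans ?_)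
      congr 1
      refine Finset.sum_congr rfl fun l hl => ?_
      rw [ih _ (by omega) (by have := Finset.mem_range.mp hl; omega)]
  by_contra! hcard
  obtain ⟨j, hj, hzj⟩ := hz0
  refine hzj ?_
  have : P = 0 := by
    refine Polynomial.eq_zero_of_degree_lt_of_eval_index_eq_zero _ ha.injOn
      (hdeg.trans_le (by exact_mod_cast hcard)) fun i hi => ?_
    rw [Finset.mem_filter, Finset.mem_range] at hi
    rw [← key p i (by omega) hi.1, hi.2]
  rw [key p j (by omega) hj, this, eval_zero]

/-- Polynomial solutions of the homogenized recurrence with interpolation weights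
satisfy fewer than `m` independent linear relations with constant coefficients. -/
theorem IsInterpolationWeight.eq_zero_of_relations {m p : ℕ} {a : ℕ → F}
    (ha : Function.Injective a) {c : ℕ → ℕ → F} (hc : IsInterpolationWeight m a c) {h : ℕ → F[X]}
    (hh : ∀ i < p, X ^ m * h i +
      ∑ l ∈ Finset.range m, C (c i l) * (X ^ (m - 1 - l) * h (i + l + 1)) = 0)
    {K : Fin m → ℕ → F} (hK : ∀ r, ∑ j ∈ Finset.range (p + m), C (K r j) * h j = 0)
    (hKli : ∀ w : Fin m → F, (∀ j < p + m, ∑ r, w r * K r j = 0) → w = 0) :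
    ∀ j < p + m, h j = 0 := by
  classical
  by_contra! hne
  -- The factor `X ^ (p + m - j)` makes the recurrence homogeneous, so each coefficient sequence `z
  -- r` satisfies the scalar recurrence.
  let z : ℕ → ℕ → F := fun r j => coeff (X ^ (p + m - j) * h j) r
  have hz : ∀ r, ∀ i < p, z r i + ∑ l ∈ Finset.range m, c i l * z r (i + l + 1) = 0 := by
    intro r i hi
    have := congrArg (fun q => coeff (X ^ (p - i) * q) r) (hh i hi)
    simp only [mul_add, mul_zero, coeff_zero, coeff_add, Finset.mul_sum, finsetSum_coeff] at this
    rw [← this]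
    simp only [z]
    congr 1
    · rw [← mul_assoc, ← pow_add]
      congr 3
      omega
    · refine Finset.sum_congr rfl fun l hl => ?_
      have := Finset.mem_range.mp hl
      rw [← coeff_C_mul, show p + m - (i + l + 1) = (p - i) + (m - 1 - l) by omega, pow_add]
      congr 1
      ring
  have hex : ∃ r, ∃ j < p + m, z r j ≠ 0 := by
    obtain ⟨j, hj, hhj⟩ := hne
    have : X ^ (p + m - j) * h j ≠ 0 := mul_ne_zero (pow_ne_zero _ X_ne_zero) hhj
    obtain ⟨r, hr⟩ : ∃ r, coeff (X ^ (p + m - j) * h j) r ≠ 0 := by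
      by_contra! hcon
      exact this (Polynomial.ext hcon)
    exact ⟨r, j, hj, hr⟩
  -- `r` is the lowest order occurring in any rescaled signal.
  set r := Nat.find hex with hr
  have hr0 : ∃ j < p + m, z r j ≠ 0 := Nat.find_spec hex
  have hrmin : ∀ r' < r, ∀ j < p + m, z r' j = 0 := fun r' hr' j hj => by
    by_contra hcon
    exact Nat.find_min hex hr' ⟨j, hj, hcon⟩
  have hcard := hc.card_zeros_lt ha (hz r) hr0
  set T := (Finset.range (p + m)).filter fun j => z r j = 0 with hT
  -- As `T` has fewer than `m` elements, some nontrivial combination `k` of the `m` relations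
  -- vanishes on `T`.
  let Ψ : (Fin m → F) →ₗ[F] (T → F) :=
    Matrix.vecMulLinear (Matrix.of fun (s : Fin m) (j : T) => K s j)
  have hker : LinearMap.ker Ψ ≠ ⊥ := LinearMap.ker_ne_bot_of_finrank_lt (by simpa using hcard)
  obtain ⟨w, hw, hw0⟩ := (Submodule.ne_bot_iff _).mp hker
  let k : ℕ → F := fun j => ∑ s, w s * K s j
  have hkT : ∀ j ∈ T, k j = 0 := fun j hj => congrFun (show Ψ w = 0 from hw) ⟨j, hj⟩
  have hk : ∃ j, j < p + m ∧ k j ≠ 0 := by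
    by_contra! hcon
    exact hw0 (hKli w hcon)
  have hsum : ∑ j ∈ Finset.range (p + m), C (k j) * h j = 0 := by
    simp only [k, map_sum, Finset.sum_mul]
    rw [Finset.sum_comm]
    refine Finset.sum_eq_zero fun s _ => ?_
    simp only [map_mul, mul_assoc]
    rw [← Finset.mul_sum, hK, mul_zero]
  set j₀ := Nat.find hk with hj₀
  obtain ⟨hj₀M, hkj₀⟩ : j₀ < p + m ∧ k j₀ ≠ 0 := Nat.find_spec hk
  have hzj₀ : z r j₀ ≠ 0 := fun hcon =>
    hkj₀ (hkT _ (Finset.mem_filter.mpr ⟨Finset.mem_range.mpr hj₀M, hcon⟩))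
  -- In degree `r + j₀` only `j = j₀` survives: `k j = 0` for `j < j₀`, and for `j > j₀` the order
  -- `r + j₀ - j` is below `r`.
  have hcoeff := congrArg (fun q => coeff (X ^ (p + m) * q) (r + j₀)) hsum
  simp only [mul_zero, coeff_zero, Finset.mul_sum, finsetSum_coeff] at hcoeff
  have hterm : ∀ j < p + m, coeff (X ^ (p + m) * (C (k j) * h j)) (r + j₀) =
      k j * if j ≤ r + j₀ then z (r + j₀ - j) j else 0 := by
    intro j hj
    rw [← coeff_X_pow_mul', ← coeff_C_mul, ← mul_assoc (X ^ j), ← pow_add,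
      show j + (p + m - j) = p + m by omega]
    congr 1
    ring
  rw [Finset.sum_eq_single j₀] at hcoeff
  · rw [hterm _ hj₀M, if_pos (by omega), Nat.add_sub_cancel] at hcoeff
    exact mul_ne_zero hkj₀ hzj₀ hcoeff
  · intro j hj hne
    rw [Finset.mem_range] at hj
    rw [hterm j hj]
    rcases lt_or_gt_of_ne hne with hlt | hgt
    · have : k j = 0 := by
        by_contra hcon
        exact Nat.find_min hk hlt ⟨hj, hcon⟩
      rw [this, zero_mul]
    · split_ifs with hle
      · rw [hrmin _ (by omega) j hj, mul_zero]
      · rw [mul_zero]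
  · intro hcon
    exact absurd (Finset.mem_range.mpr hj₀M) hcon

end Interpolation

/-! ### A system non-degenerate over every extension field -/

namespace LinearSystem

variable {n m p : ℕ}

section CommRing

variable {R R' : Type*} [CommRing R] [CommRing R']

/-- The block observer form with states `x i l` (`i < p`, `l < m`), embedded in `n` states through
`e`: the outputs are `h i = x i 0` and the equations are `s x i l = x i (l + 1) - c i l h (i + l + 1)`,
where `x i m = 0` and `h (p + j)` is the input `j`. -/
def observerForm (e : Fin p × Fin m ↪ Fin n) (c : ℕ → ℕ → R) : LinearSystem R n m p :=
  let P : Matrix (Fin p × Fin m) (Fin n) R := Matrix.of fun s a => if e s = a then 1 else 0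
  let A₀ : Matrix (Fin p × Fin m) (Fin p × Fin m) R := Matrix.of fun s t =>
    (if t.1.1 = s.1 ∧ t.2.1 = s.2 + 1 then 1 else 0) -
      if t.1.1 = s.1 + s.2 + 1 ∧ t.2.1 = 0 then c s.1 s.2 else 0
  let B₀ : Matrix (Fin p × Fin m) (Fin m) R := Matrix.of fun s j =>
    if p + j.1 = s.1 + s.2 + 1 then c s.1 s.2 else 0
  let C₀ : Matrix (Fin p) (Fin p × Fin m) R := Matrix.of fun i t =>
    if t.1.1 = i.1 ∧ t.2.1 = 0 then 1 else 0
  { A := P.transpose * A₀ * P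
    B := P.transpose * B₀
    C := C₀ * P }

theorem observerForm_map (φ : R →+* R') (e : Fin p × Fin m ↪ Fin n) (c : ℕ → ℕ → R) :
    (observerForm e c).map φ = observerForm e fun i l => φ (c i l) := by
  simp only [map, observerForm, Matrix.map_mul, mk.injEq]
  refine ⟨?_, ?_, ?_⟩ <;> congr 1
  · congr 1
    all_goals ext; simp [apply_ite φ]
  all_goals ext; simp [apply_ite φ]

theorem sum_ite_mul_eq_dite (y : Fin p × Fin m → R) (a b : ℕ) (k : R) :
    ∑ t : Fin p × Fin m, (if t.1.1 = a ∧ t.2.1 = b then k else 0) * y t =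
      k * if h : a < p ∧ b < m then y (⟨a, h.1⟩, ⟨b, h.2⟩) else 0 := by
  split_ifs with h
  · rw [Finset.sum_eq_single (⟨a, h.1⟩, ⟨b, h.2⟩)]
    · simp
    · intro t _ ht
      rw [if_neg, zero_mul]
      rintro ⟨h1, h2⟩
      exact ht (Prod.ext (Fin.ext h1) (Fin.ext h2))
    · simp
  · rw [mul_zero]
    refine Finset.sum_eq_zero fun t _ => ?_
    rw [if_neg, zero_mul]
    rintro ⟨rfl, rfl⟩
    exact h ⟨t.1.2, t.2.2⟩

theorem sum_ite_add_mul_eq_dite (u : Fin m → R) (a : ℕ) (k : R) :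
    ∑ j : Fin m, (if p + j.1 = a then k else 0) * u j =
      k * if h : p ≤ a ∧ a - p < m then u ⟨a - p, h.2⟩ else 0 := by
  split_ifs with h
  · rw [Finset.sum_eq_single ⟨a - p, h.2⟩]
    · rw [if_pos]
      simp only
      omega
    · intro j _ hj
      rw [if_neg, zero_mul]
      rintro rfl
      exact hj (Fin.ext (by simp))
    · simp
  · rw [mul_zero]
    refine Finset.sum_eq_zero fun j _ => ?_
    rw [if_neg, zero_mul]
    rintro rfl
    exact h ⟨by omega, by omega⟩

/-- The signals `h` of the observer form: the outputs `h i` for `i < p`, then the inputs. -/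
def signal (y : Fin p × Fin m → R) (u : Fin m → R) (a : ℕ) : R :=
  (if h : a < p ∧ 0 < m then y (⟨a, h.1⟩, ⟨0, h.2⟩) else 0) +
    if h : p ≤ a ∧ a - p < m then u ⟨a - p, h.2⟩ else 0

/-- Multiplying the equation for `x i l` by `s ^ (m - 1 - l)` and summing over `l` telescopes the
states away, leaving `s ^ m h i`. The kernel equation reads `s x = A x - B u`, which is why `c`
enters `A` and `B` with opposite signs. -/
theorem exists_signal_recurrence (e : Fin p × Fin m ↪ Fin n) (c : ℕ → ℕ → R)
    {x : Fin n → R[X]} {u : Fin m → R[X]}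
    (hxu : Matrix.mulVec (observerForm e c).A.charmatrix x +
      Matrix.mulVec ((observerForm e c).B.map Polynomial.C) u = 0) :
    ∃ y : Fin p × Fin m → R[X],
      (∀ i : Fin p, Matrix.mulVec ((observerForm e c).C.map Polynomial.C) x i = signal y u i) ∧
      ∀ i < p, X ^ m * signal y u i + ∑ l ∈ Finset.range m,
        Polynomial.C (c i l) * (X ^ (m - 1 - l) * signal y u (i + l + 1)) = 0 := by
  let P : Matrix (Fin p × Fin m) (Fin n) R := Matrix.of fun s a => if e s = a then 1 else 0
  let y : Fin p × Fin m → R[X] := Matrix.mulVec (P.map Polynomial.C) x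
  have hPP : P * P.transpose = 1 := by
    ext s t
    simp [P, Matrix.mul_apply, Matrix.one_apply, e.injective.eq_iff, eq_comm]
  refine ⟨y, ?_, ?_⟩
  · intro i
    have h1 : Matrix.mulVec ((observerForm e c).C.map Polynomial.C) x = Matrix.mulVec
        ((Matrix.of fun (i : Fin p) (t : Fin p × Fin m) =>
          if t.1.1 = i.1 ∧ t.2.1 = 0 then (1 : R) else 0).map Polynomial.C) y := by
      simp only [observerForm, Matrix.map_mul, y, Matrix.mulVec_mulVec, P]
    rw [h1]
    have := sum_ite_mul_eq_dite y i.1 0 1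
    simp only [Matrix.mulVec, dotProduct, Matrix.map_apply, Matrix.of_apply, apply_ite,
      map_one, map_zero, this, signal, one_mul]
    rw [dif_neg (c := p ≤ i.1 ∧ i.1 - p < m) (by omega), add_zero]
  · let η : ℕ → ℕ → R[X] := fun i l => if h : i < p ∧ l < m then y (⟨i, h.1⟩, ⟨l, h.2⟩) else 0
    have hstate : ∀ i < p, ∀ l < m,
        X * η i l = η i (l + 1) - Polynomial.C (c i l) * signal y u (i + l + 1) := by
      intro i hi l hl
      have h1 := congrFun (congrArg (Matrix.mulVec (P.map Polynomial.C)) hxu) (⟨i, hi⟩, ⟨l, hl⟩)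
      have h2 : ∀ M : Matrix (Fin p × Fin m) (Fin p × Fin m) R,
          Matrix.mulVec (P.map Polynomial.C)
            (Matrix.mulVec (P.transpose * M * P).charmatrix x) =
            (X : R[X]) • y - Matrix.mulVec (M.map Polynomial.C) y := fun M => by
        have hX : Matrix.mulVec (Matrix.scalar (Fin n) (X : R[X])) x = (X : R[X]) • x := by
          ext1 s
          simp [Matrix.scalar_apply, Matrix.mulVec_diagonal]
        rw [Matrix.charmatrix, Matrix.sub_mulVec, hX, Matrix.mulVec_sub, Matrix.mulVec_smul,
          RingHom.mapMatrix_apply, Matrix.mulVec_mulVec, ← Matrix.map_mul, Matrix.mul_assoc,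
          ← Matrix.mul_assoc P, hPP, Matrix.one_mul, Matrix.map_mul, ← Matrix.mulVec_mulVec]
      have h3 : ∀ M : Matrix (Fin p × Fin m) (Fin m) R, Matrix.mulVec (P.map Polynomial.C)
          (Matrix.mulVec ((P.transpose * M).map Polynomial.C) u) =
            Matrix.mulVec (M.map Polynomial.C) u := fun M => by
        rw [Matrix.mulVec_mulVec, ← Matrix.map_mul, ← Matrix.mul_assoc, hPP, Matrix.one_mul]
      rw [Matrix.mulVec_add] at h1
      simp only [observerForm] at h1
      rw [h2, h3] at h1
      have h4 := sum_ite_mul_eq_dite y i (l + 1) 1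
      have h5 := sum_ite_mul_eq_dite y (i + l + 1) 0 (Polynomial.C (c i l))
      have h6 := sum_ite_add_mul_eq_dite (p := p) u (i + l + 1) (Polynomial.C (c i l))
      simp only [Matrix.mulVec, dotProduct, Matrix.map_apply, Matrix.of_apply, map_sub,
        apply_ite (⇑(Polynomial.C : R →+* R[X])), map_one, map_zero, sub_mul, Finset.sum_sub_distrib, h4, h5, h6, Pi.add_apply,
        Pi.sub_apply, Pi.smul_apply, smul_eq_mul, Pi.zero_apply, one_mul, mul_zero,
        Finset.sum_const_zero] at h1
      have h7 : η i l = y (⟨i, hi⟩, ⟨l, hl⟩) := dif_pos ⟨hi, hl⟩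
      rw [h7, signal]
      simp only [η]
      linear_combination h1
    intro i hi
    have htel := Finset.sum_range_sub' (fun l => X ^ (m - l) * η i l) m
    have hη0 : signal y u i = η i 0 := by
      simp only [signal, η]
      rw [dif_neg (c := p ≤ i ∧ i - p < m) (by omega), add_zero]
    have hηm : η i m = 0 := dif_neg (by omega)
    rw [hηm, mul_zero, sub_zero, Nat.sub_zero] at htel
    rw [hη0, ← htel, ← Finset.sum_add_distrib]
    refine Finset.sum_eq_zero fun l hl => ?_
    rw [Finset.mem_range] at hl
    have := hstate i hi l hl
    rw [show m - l = m - 1 - l + 1 by omega, show m - (l + 1) = m - 1 - l by omega, pow_succ,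
      mul_assoc, this]
    ring

end CommRing

/-- For `m * p ≤ n`, a system over an infinite field that is non-degenerate over every extension
field. -/
theorem exists_closedLoopPoly_ne_zero {F : Type u} [Field F] [Infinite F] (hmn : m * p ≤ n) :
    ∃ S : LinearSystem F n m p, ∀ (E : Type u) [Field E] (φ : F →+* E)
      (K : Matrix (Fin m) (Fin m ⊕ Fin p) E) (g : Fin m → Fin m ⊕ Fin p),
      (K.submatrix id g).det ≠ 0 → (S.map φ).closedLoopPoly K ≠ 0 := by
  let e : Fin p × Fin m ↪ Fin n :=
    finProdFinEquiv.toEmbedding.trans (Fin.castLEEmb (by rwa [mul_comm]))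
  let a : ℕ ↪ F := Infinite.natEmbedding F
  obtain ⟨c, hc⟩ := exists_isInterpolationWeight m a.injective
  refine ⟨observerForm e c, fun E _ φ K g hg hzero => ?_⟩
  rw [observerForm_map] at hzero
  replace hc := hc.map φ
  have ha : Function.Injective fun i => φ (a i) := φ.injective.comp a.injective
  rw [closedLoopPoly, ← Matrix.exists_mulVec_eq_zero_iff] at hzero
  obtain ⟨v, hv0, hv⟩ := hzero
  obtain ⟨x, u, rfl⟩ : ∃ x u, v = Sum.elim x u := ⟨v ∘ Sum.inl, v ∘ Sum.inr, by simp⟩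
  rw [Matrix.fromBlocks_mulVec, Sum.elim_comp_inl, Sum.elim_comp_inr] at hv
  have hv₁ := _root_.funext fun i => congrFun hv (Sum.inl i)
  have hv₂ := _root_.funext fun i => congrFun hv (Sum.inr i)
  simp only [Sum.elim_inl, Sum.elim_inr, Pi.zero_apply] at hv₁ hv₂
  obtain ⟨y, hy, hrec⟩ := exists_signal_recurrence e (fun i l => φ (c i l)) hv₁
  -- The columns of `K` are reordered to match the signals: outputs first, then inputs.
  let K' : Fin m → ℕ → E := fun r j =>
    if h : j < p then K r (Sum.inr ⟨j, h⟩) else if h : j - p < m then K r (Sum.inl ⟨j - p, h⟩) else 0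
  have hK'₁ : ∀ r (i : Fin p), K' r i = K r (Sum.inr i) := fun r i => by simp [K']
  have hK'₂ : ∀ r (j : Fin m), K' r (p + j) = K r (Sum.inl j) := fun r j => by simp [K']
  have hu : ∀ j : Fin m, signal y u (p + j) = u j := fun j => by simp [signal]
  have hsig := hc.eq_zero_of_relations ha hrec (K := K') ?_ ?_
  · have hu0 : u = 0 := _root_.funext fun j => by
      rw [← hu j, hsig _ (by omega), Pi.zero_apply]
    refine hv0 ?_
    have hx0 : x = 0 := by
      by_contra hx
      refine ((observerForm e fun i l => φ (c i l)).A.charpoly_monic).ne_zero ?_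
      rw [Matrix.charpoly, ← Matrix.exists_mulVec_eq_zero_iff]
      refine ⟨x, hx, ?_⟩
      rw [hu0, Matrix.mulVec_zero, add_zero] at hv₁
      exact hv₁
    rw [hx0, hu0]
    exact Sum.elim_zero_zero
  · intro r
    have h1 := congrFun hv₂ r
    rw [Matrix.map_mul, ← Matrix.mulVec_mulVec, _root_.funext hy] at h1
    rw [Finset.sum_range, Fin.sum_univ_add]
    simpa [hK'₁, hK'₂, hu, Matrix.mulVec, dotProduct] using h1
  · intro w hw
    by_contra hw0
    refine hg (Matrix.exists_vecMul_eq_zero_iff.mp ⟨w, hw0, ?_⟩)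
    ext1 s
    simp only [Matrix.vecMul, dotProduct, Matrix.submatrix_apply, id_eq, Pi.zero_apply]
    rcases g s with j | i
    · simpa [hK'₂] using hw (p + j) (by omega)
    · simpa [hK'₁] using hw i (by omega)

end LinearSystem

/-! ### Valuation rings and elimination -/

namespace Matrix

/-- Over a field with a valuation subring `V`, a matrix of full row rank becomes, after
multiplication by an invertible matrix, a matrix over `V` with a minor equal to `1`. -/
theorem exists_mul_mem_valuationSubring {L ι : Type*} [Field L] [Finite ι] {m : ℕ}
    (V : ValuationSubring L) {K : Matrix (Fin m) ι L} {g : Fin m → ι}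
    (hg : (K.submatrix id g).det ≠ 0) :
    ∃ (T : Matrix (Fin m) (Fin m) L) (K' : Matrix (Fin m) ι V) (g' : Fin m → ι),
      T * K = K'.map V.subtype ∧ K'.submatrix id g' = 1 := by
  classical
  have := Fintype.ofFinite ι
  -- Choose a minor of largest valuation. By Cramer's rule the entries of `M⁻¹ K` are quotients of
  -- minors by it, hence lie in `V`.
  obtain ⟨g', -, hmax⟩ := Finset.exists_max_image Finset.univ
    (fun g : Fin m → ι => V.valuation (K.submatrix id g).det) ⟨g, Finset.mem_univ g⟩
  have hg' : (K.submatrix id g').det ≠ 0 := fun h => hg <| by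
    have := hmax g (Finset.mem_univ g)
    simpa [h] using this
  set M := K.submatrix id g' with hM
  have hMu : IsUnit M.det := isUnit_iff_ne_zero.mpr hg'
  have hentry : ∀ i j, (M⁻¹ * K) i j =
      (K.submatrix id (Function.update g' i j)).det / M.det := by
    intro i j
    have h1 : K.submatrix id (Function.update g' i j) = M.updateCol i (K.col j) := by
      ext r s
      by_cases h : s = i
      · subst h; simp [Matrix.col]
      · simp [h, hM]
    have h2 : (M⁻¹ * K) i j = M⁻¹.mulVec (K.col j) i := rfl
    rw [h1, ← Matrix.cramer_apply, h2, Matrix.inv_def, Matrix.smul_mulVec, Pi.smul_apply,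
      ← Matrix.cramer_eq_adjugate_mulVec, Ring.inverse_eq_inv', smul_eq_mul, div_eq_inv_mul]
  have hmem : ∀ i j, (M⁻¹ * K) i j ∈ V := by
    intro i j
    rw [hentry, ← V.valuation_le_one_iff, map_div₀]
    exact div_le_one_of_le₀ (hmax _ (Finset.mem_univ _)) zero_le
  refine ⟨M⁻¹, of fun i j => ⟨_, hmem i j⟩, g', rfl, ?_⟩
  ext i j
  have h3 : (M⁻¹ * K).submatrix id g' = 1 := by
    rw [← Matrix.nonsing_inv_mul _ hMu]
    rfl
  have h4 : ((1 : Matrix (Fin m) (Fin m) V) i j : L) = (1 : Matrix (Fin m) (Fin m) L) i j := by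
    by_cases h : i = j <;> simp [Matrix.one_apply, h]
  rw [h4, ← h3]
  rfl

end Matrix

/-- Given an embedding of a domain into a field `L` and a prime, there is a map from a valuation
subring of `L` to a field whose kernel contains the prime. -/
theorem exists_valuationSubring_residueField {R L : Type u} [CommRing R] [Field L] (φ : R →+* L)
    (hφ : Function.Injective φ) {I : Ideal R} (hI : I ≠ ⊤) :
    ∃ (V : ValuationSubring L) (ψ : R →+* V) (κ : Type u) (_ : Field κ) (π : V →+* κ),
      V.subtype.comp ψ = φ ∧ ∀ x ∈ I, π (ψ x) = 0 := by
  have hbij : Function.Bijective φ.rangeRestrict :=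
    ⟨fun x y h => hφ (congrArg Subtype.val h), φ.rangeRestrict_surjective⟩
  let e := RingEquiv.ofBijective φ.rangeRestrict hbij
  obtain ⟨V, hV, hVI⟩ := (I.map e).image_subset_nonunits_valuationSubring (by
    intro h
    refine hI ?_
    rw [← Ideal.comap_map_of_bijective e e.bijective (I := I), h, Ideal.comap_top])
  refine ⟨V, (Subring.inclusion hV).comp φ.rangeRestrict, IsLocalRing.ResidueField V,
    inferInstance, IsLocalRing.residue V, rfl, fun x hx => ?_⟩
  rw [IsLocalRing.residue_eq_zero_iff]
  exact V.coe_mem_nonunits_iff.mp (hVI ⟨e x, Ideal.mem_map_of_mem e hx, rfl⟩)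

/-- If `J` has no zero with `d ≠ 0` in a field containing the domain `A`, then `J` contains the
product of a nonzero element of `A` and a power of `d`. -/
theorem Ideal.exists_map_mul_pow_mem {A Q : Type u} [CommRing A] [IsDomain A] [CommRing Q]
    (ι : A →+* Q) (J : Ideal Q) (d : Q)
    (h : ∀ (L : Type u) [Field L] (θ : Q →+* L), Function.Injective (θ.comp ι) → θ d ≠ 0 →
      ∃ x ∈ J, θ x ≠ 0) : ∃ a ≠ 0, ∃ N : ℕ, ι a * d ^ N ∈ J := by
  -- If `J` missed `M`, a prime containing `J` and disjoint from `M` would give, in the fraction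
  -- field of its quotient, a zero of `J` excluded by `h`.
  let M : Submonoid Q := (nonZeroDivisors A).map ι ⊔ Submonoid.powers d
  have hmeet : ¬ Disjoint (J : Set Q) M := by
    intro hdisj
    obtain ⟨P, hP, hJP, hPM⟩ := Ideal.exists_le_prime_disjoint J M hdisj
    let θ : Q →+* FractionRing (Q ⧸ P) := (algebraMap (Q ⧸ P) _).comp (Ideal.Quotient.mk P)
    have hθ : ∀ x, θ x = 0 ↔ x ∈ P := fun x => by
      simp [θ, Ideal.Quotient.eq_zero_iff_mem]
    have hθM : ∀ x ∈ M, θ x ≠ 0 := fun x hx h =>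
      Set.disjoint_left.mp hPM ((hθ x).mp h) hx
    obtain ⟨x, hxJ, hx⟩ := h _ θ (by
      rw [injective_iff_map_eq_zero]
      intro a ha
      by_contra ha0
      exact hθM _ (Submonoid.mem_sup_left
        (Submonoid.mem_map_of_mem _ (mem_nonZeroDivisors_of_ne_zero ha0))) ha)
      (hθM _ (Submonoid.mem_sup_right (Submonoid.mem_powers _)))
    exact hx ((hθ x).mpr (hJP hxJ))
  obtain ⟨x, hxJ, hxM⟩ := Set.not_disjoint_iff.mp hmeet
  obtain ⟨_, ⟨a, ha, rfl⟩, _, ⟨N, rfl⟩, rfl⟩ := Submonoid.mem_sup.mp hxM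
  exact ⟨a, nonZeroDivisors.ne_zero ha, N, hxJ⟩

/-! ### Specialization from the generic system -/

namespace LinearSystem

variable {n m p : ℕ}

/-- The system whose coefficients are indeterminates. -/
def generic (F : Type*) [Field F] (n m p : ℕ) :
    LinearSystem (MvPolynomial (Coord n m p) F) n m p :=
  coords.symm MvPolynomial.X

theorem generic_map_eval {F : Type*} [Field F] (S : LinearSystem F n m p) :
    (generic F n m p).map (MvPolynomial.eval S.coords) = S := by
  have h : (generic F n m p).map (MvPolynomial.eval S.coords) =
      coords.symm (MvPolynomial.eval S.coords ∘ MvPolynomial.X) := rfl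
  rw [h, show MvPolynomial.eval S.coords ∘ MvPolynomial.X = S.coords from
    _root_.funext (MvPolynomial.eval_X), Equiv.symm_apply_apply]

theorem map_map {R R' R'' : Type*} (φ : R → R') (ψ : R' → R'') (S : LinearSystem R n m p) :
    (S.map φ).map ψ = S.map (ψ ∘ φ) := rfl

/-- If some system over `F` is non-degenerate over every extension field, then the generic system
is non-degenerate over every field. -/
theorem generic_closedLoopPoly_ne_zero {F : Type u} [Field F] {S : LinearSystem F n m p}
    (hS : ∀ (E : Type u) [Field E] (φ : F →+* E) (K : Matrix (Fin m) (Fin m ⊕ Fin p) E)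
      (g : Fin m → Fin m ⊕ Fin p), (K.submatrix id g).det ≠ 0 → (S.map φ).closedLoopPoly K ≠ 0)
    {L : Type u} [Field L] (φ : MvPolynomial (Coord n m p) F →+* L) (hφ : Function.Injective φ)
    {K : Matrix (Fin m) (Fin m ⊕ Fin p) L} {g : Fin m → Fin m ⊕ Fin p}
    (hg : (K.submatrix id g).det ≠ 0) : ((generic F n m p).map φ).closedLoopPoly K ≠ 0 := by
  intro hzero
  obtain ⟨V, ψ, κ, _, π, rfl, hker⟩ := exists_valuationSubring_residueField φ hφ
    (RingHom.ker_ne_top (MvPolynomial.eval S.coords))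
  obtain ⟨T, K', g', hT, hg'⟩ := Matrix.exists_mul_mem_valuationSubring V hg
  have h1 : ((generic F n m p).map ψ).closedLoopPoly K' = 0 := by
    refine Polynomial.map_injective V.subtype V.subtype_injective ?_
    rw [← closedLoopPoly_map, ← hT, map_map, closedLoopPoly_mul]
    rw [RingHom.coe_comp] at hzero
    rw [hzero, mul_zero, Polynomial.map_zero]
  -- Modulo the maximal ideal of `V`, a polynomial agrees with its value at `S`, so the generic
  -- system reduces to `S`.
  have h2 : ∀ f, π (ψ f) = π (ψ (MvPolynomial.C (MvPolynomial.eval S.coords f))) := fun f => by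
    rw [← sub_eq_zero, ← map_sub, ← map_sub]
    exact hker _ (by simp [RingHom.mem_ker])
  have h3 : S.map ((π.comp ψ).comp MvPolynomial.C) = ((generic F n m p).map ψ).map π := by
    conv_lhs => rw [← generic_map_eval S]
    rw [map_map, map_map]
    congr 1
    exact _root_.funext fun f => (h2 f).symm
  refine hS κ ((π.comp ψ).comp MvPolynomial.C) (K'.map π) g' ?_ ?_
  -- The minor normalized to the identity survives reduction, so the reduced compensator keeps full
  -- rank.
  · have h4 : (K'.map π).submatrix id g' = (K'.submatrix id g').map π := rfl
    rw [h4, hg', Matrix.map_one _ π.map_zero π.map_one, Matrix.det_one]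
    exact one_ne_zero
  · rw [h3, closedLoopPoly_map, h1, Polynomial.map_zero]

/-- For every set of `m` columns there is a nonzero polynomial in the coefficients of the system
vanishing at the systems that are degenerate for some `K` with invertible minor at these columns. -/
theorem exists_eval_eq_zero {F : Type u} [Field F] {S : LinearSystem F n m p}
    (hS : ∀ (E : Type u) [Field E] (φ : F →+* E) (K : Matrix (Fin m) (Fin m ⊕ Fin p) E)
      (g : Fin m → Fin m ⊕ Fin p), (K.submatrix id g).det ≠ 0 → (S.map φ).closedLoopPoly K ≠ 0)
    (g : Fin m → Fin m ⊕ Fin p) :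
    ∃ δ : MvPolynomial (Coord n m p) F, δ ≠ 0 ∧ ∀ (S' : LinearSystem F n m p)
      (K : Matrix (Fin m) (Fin m ⊕ Fin p) F), (K.submatrix id g).det ≠ 0 →
        S'.closedLoopPoly K = 0 → MvPolynomial.eval S'.coords δ = 0 := by
  let A := MvPolynomial (Coord n m p) F
  let Q := MvPolynomial (Fin m × (Fin m ⊕ Fin p)) A
  let Kgen : Matrix (Fin m) (Fin m ⊕ Fin p) Q := Matrix.of fun i j => MvPolynomial.X (i, j)
  let f : Q[X] := ((generic F n m p).map (MvPolynomial.C : A →+* Q)).closedLoopPoly Kgen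
  -- The zeros of `J` are the pairs of a system and a compensator with vanishing closed-loop
  -- polynomial.
  let J : Ideal Q := Ideal.span (Set.range f.coeff)
  obtain ⟨δ, hδ, N, hN⟩ := J.exists_map_mul_pow_mem (MvPolynomial.C : A →+* Q)
    (Kgen.submatrix id g).det fun L _ θ hinj hdet => by
      by_contra! hJ
      refine generic_closedLoopPoly_ne_zero hS (θ.comp MvPolynomial.C) hinj (K := Kgen.map θ)
        (g := g) ?_ ?_
      · have h1 : (Kgen.map θ).submatrix id g = θ.mapMatrix (Kgen.submatrix id g) := rfl
        rwa [h1, ← RingHom.map_det]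
      · rw [RingHom.coe_comp, ← map_map, closedLoopPoly_map]
        ext k
        rw [coeff_map, coeff_zero]
        exact hJ _ (Ideal.subset_span ⟨k, rfl⟩)
  refine ⟨δ, hδ, fun S' K hK hS' => ?_⟩
  let θ : Q →+* F := MvPolynomial.eval₂Hom (MvPolynomial.eval S'.coords) fun ij => K ij.1 ij.2
  have hθC : θ.comp MvPolynomial.C = MvPolynomial.eval S'.coords := by
    exact MvPolynomial.eval₂Hom_comp_C _ _
  have hθK : Kgen.map θ = K := by
    ext i j
    exact MvPolynomial.eval₂Hom_X' _ _ (i, j)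
  have hf : f.map θ = 0 := by
    rw [← closedLoopPoly_map, map_map, ← RingHom.coe_comp, hθC, generic_map_eval, hθK, hS']
  have hJ : J ≤ RingHom.ker θ := by
    rw [Ideal.span_le]
    rintro _ ⟨k, rfl⟩
    rw [SetLike.mem_coe, RingHom.mem_ker, ← coeff_map, hf, coeff_zero]
  have h1 : θ (MvPolynomial.C δ * (Kgen.submatrix id g).det ^ N) = 0 := hJ hN
  have h2 : θ (Kgen.submatrix id g).det = (K.submatrix id g).det := by
    rw [RingHom.map_det, ← hθK]
    rfl
  have h3 : θ (MvPolynomial.C δ) = MvPolynomial.eval S'.coords δ := RingHom.congr_fun hθC δ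
  rw [map_mul, map_pow, h2, h3] at h1
  exact (mul_eq_zero.mp h1).resolve_right (pow_ne_zero _ hK)

theorem exists_isZariskiClosed_of_le {F : Type u} [Field F] [Infinite F] (hmn : m * p ≤ n) :
    ∃ Z : Set (Coord n m p → F), IsZariskiClosed Z ∧ Z ≠ Set.univ ∧
      ∀ S : LinearSystem F n m p, S.coords ∉ Z → ¬ S.IsDegenerate := by
  obtain ⟨S₀, hS₀⟩ := exists_closedLoopPoly_ne_zero (F := F) hmn
  choose δ hδ0 hδ using exists_eval_eq_zero hS₀
  refine ⟨{x | MvPolynomial.eval x (∏ g, δ g) = 0}, ⟨{∏ g, δ g}, by simp⟩, ?_, ?_⟩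
  · intro h
    refine Finset.prod_ne_zero_iff.mpr (fun g _ => hδ0 g)
      (MvPolynomial.funext fun x => ?_ : ∏ g, δ g = 0)
    rw [map_zero]
    exact Set.eq_univ_iff_forall.mp h x
  · intro S hSZ hS
    obtain ⟨K, hK, hzero⟩ := hS.exists_closedLoopPoly_eq_zero
    obtain ⟨g, hg⟩ := Matrix.exists_det_submatrix_ne_zero hK
    refine hSZ ?_
    rw [Set.mem_ofPred_eq, map_prod]
    exact Finset.prod_eq_zero (Finset.mem_univ g) (hδ g S K hg hzero)

end LinearSystem
end

theorem theorem3 {F : Type*} [Field F] (n m p : ℕ) :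
    (n < m * p → ∀ S : LinearSystem F n m p,
      HasMcMillanDegree S.transferFunction n → S.IsDegenerate) ∧
    (IsAlgClosed F → m * p ≤ n →
      ∃ Z : Set (LinearSystem.Coord n m p → F),
        IsZariskiClosed Z ∧ Z ≠ Set.univ ∧
        ∀ S : LinearSystem F n m p, S.coords ∉ Z → ¬ S.IsDegenerate) := by
  refine ⟨fun h S _ => S.isDegenerate_of_lt h, fun _ hmn => ?_⟩
  -- Algebraic closedness enters only through infinitude of `F`: it supplies distinct nodes and a
  -- point where a nonzero polynomial does not vanish.
  exact LinearSystem.exists_isZariskiClosed_of_le hmn
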